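/- Setting. Let $E$ be a countable set of events, $\mathcal A$ a set of participants and $\pi:E\to\mathcal A$. A CES $\mathcal E=\langle\#,\vdash,\Vdash\rangle$ consists of an irreflexive symmetric conflict relation $\#$ on $E$ and two relations $\vdash,\Vdash$ between finite conflict-free subsets of $E$ and $E$, both saturated ($X\circ e$, $X\subseteq Y$ finite and $Y$ conflict-free imply $Y\circ e$). $\mathcal E$ is conflict-free if $\#=\emptyset$. A play is a finite or infinite conflict-free sequence over $E$ without repetitions. For $\sigma=\langle e_0e_1\cdots\rangle$ let $\overline\sigma$ be its set of events and $\sigma_i=\langle e_0\cdots e_{i-1}\rangle$ (with $\sigma_i=\sigma$ for $i\ge|\sigma|$). For finite $\eta=\langle e_0\cdots e_n\rangle$ let $\mathcal C(\eta)=\{e_i : \overline{\eta_i}\not\vdash e_i \text{ and } \overline\eta\not\Vdash e_i\}$ be the set of credits. A strategy $\Sigma$ for $A\in\mathcal A$ maps each finite play $\sigma$ to a set of events $e\in\pi^{-1}(A)$ such that $\sigma e$ is a play. A play $\sigma$ conforms to $\Sigma$ if $e_i\in\Sigma(\sigma_i)$ whenever $\pi(e_i)=A$. It is fair w.r.t.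 $\Sigma$ if for every $e$ and every $i\le|\sigma|$: if $e\in\Sigma(\sigma_j)$ for all $j$ with $i\le j\le|\sigma|$, then $e_h=e$ for some $h\ge i$. Prudence and innocence are given by a mutual recursion: * $e$ is prudent in the finite sequence $\sigma$ iff, for some participant $A$, there is a strategy $\Sigma$ for $A$, to which $\sigma$ conforms, with $e\in\Sigma(\sigma)$, such that for every fair play $\sigma'$ extending $\sigma$, conforming to $\Sigma$, in which all $B\ne A$ are innocent, there is $k>|\sigma|$ with $\mathcal C(\sigma'_k)\cap\pi^{-1}(A)\subseteq\mathcal C(\sigma)$; * $A$ is innocent in $\sigma$ iff for all $e\in\pi^{-1}(A)$ and all $i\ge0$ there is $j\ge i$ such that $e$ is not prudent in $\sigma_j$. The right-hand side is a monotone operator on the predicate "$e$ is prudent in $\sigma$"; prudence is its least solution (equivalently, innocence is the largest, i.e. coinductive, one). A finite play $\sigma=\langle e_0\cdots e_{n-1}\rangle$ is a prudent play of $\mathcal E$ if $e_i$ is prudent in $\sigma_i$ for all $i<n$. A Horn PCL theory $\Delta$ is a set of clauses $\alpha\to a$ and $\alpha\twoheadrightarrow a$, where $a\in E$ and $\alpha$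 is a finite (possibly empty) conjunction of atoms in $E$, with set of atoms $\overline\alpha$; the atom $a$ abbreviates $\top\to a$. The set $[\![\Delta]\!]$ of proof traces is the least family of sets of finite sequences such that: $\epsilon\in[\![\Delta]\!]$; if $\alpha\to a\in\Delta$, $\sigma\in[\![\Delta]\!]$ and $\overline\alpha\subseteq\overline\sigma$, then $\sigma a\in[\![\Delta]\!]$; if $\alpha\twoheadrightarrow a\in\Delta$, $\sigma\in[\![\Delta\cup\{a\}]\!]$ and $\overline\alpha\subseteq\overline\sigma$, then every interleaving of $\sigma$ and $a$ is in $[\![\Delta]\!]$; here repeated occurrences in $\sigma a$ and in interleavings are deleted, keeping the leftmost. Write $\Delta\sim\mathcal E$ if $\mathcal E$ is conflict-free and $\Delta=\{(\bigwedge X)\to e : X\vdash e\}\cup\{(\bigwedge X)\twoheadrightarrow e : X\Vdash e\}$. Theorem. Let $\Delta\sim\mathcal E$. For every finite sequence $\sigma$ over $E$: $\sigma$ is a prudent play of $\mathcal E$ if and only if $\sigma$ is a prefix of some element of $[\![\Delta]\!]$. Moreover, if only finitely many events $e$ occur in enablings $X\vdash e$ or $X\Vdash e$ (in particular, if $E$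 is finite), the same equivalence holds when prudence is taken to be any solution of the mutual recursion (in particular, the greatest one). -/

import Mathlib

/-! ### Event structures with circular causality (CES) -/

/-- An event structure with circular causality over the universe `E` of events:
`enables X e` is `X ⊢ e` and `circEnables X e` is `X ⊩ e`. -/
structure CES (E : Type*) where
  conflict : E → E → Prop
  conflict_irrefl : ∀ a, ¬ conflict a a
  conflict_symm : ∀ a b, conflict a b → conflict b a
  enables : Finset E → E → Prop
  circEnables : Finset E → E → Prop
  enables_con : ∀ X e, enables X e → ∀ a ∈ X, ∀ b ∈ X, ¬ conflict a b
  circEnables_con : ∀ X e, circEnables X e → ∀ a ∈ X, ∀ b ∈ X, ¬ conflict a b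
  enables_saturated : ∀ X Y e, X ⊆ Y → enables X e →
    (∀ a ∈ Y, ∀ b ∈ Y, ¬ conflict a b) → enables Y e
  circEnables_saturated : ∀ X Y e, X ⊆ Y → circEnables X e →
    (∀ a ∈ Y, ∀ b ∈ Y, ¬ conflict a b) → circEnables Y e

namespace CES

variable {E 𝒜 : Type*}

/-- A CES is conflict-free when its conflict relation is empty. -/
def ConflictFree (𝓔 : CES E) : Prop := ∀ a b, ¬ 𝓔.conflict a b

/-- A finite play: a finite conflict-free sequence without repetitions. -/
def IsFinPlay (𝓔 : CES E) (σ : List E) : Prop :=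
  σ.Nodup ∧ ∀ a ∈ σ, ∀ b ∈ σ, ¬ 𝓔.conflict a b

/-- A play: a finite or infinite conflict-free sequence without repetitions.
For `s : Stream'.Seq E`, the event `e_i` is `s.get? i` (if it exists), and `s.take i` is the
prefix `⟨e_0 ⋯ e_{i-1}⟩` (the whole of `s` when `i` exceeds the length of `s`). -/
def IsPlay (𝓔 : CES E) (s : Stream'.Seq E) : Prop :=
  (∀ i j e, s.get? i = some e → s.get? j = some e → i = j) ∧
    ∀ a ∈ s, ∀ b ∈ s, ¬ 𝓔.conflict a b

open Classical in
/-- The events done on credit in the finite sequence `η`. -/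
noncomputable def credit (𝓔 : CES E) (η : List E) : Set E :=
  {e | ∃ i, η[i]? = some e ∧ ¬ 𝓔.enables (η.take i).toFinset e ∧
    ¬ 𝓔.circEnables η.toFinset e}

/-! ### The game: strategies, fairness, innocence, prudence -/

/-- A strategy for participant `A`: to each finite play it associates a set of events of `A`
whose execution yields a play. (On lists that are not plays the set is forced to be empty.) -/
structure Strategy (𝓔 : CES E) (π : E → 𝒜) (A : 𝒜) where
  toFun : List E → Set E
  owner : ∀ σ, ∀ e ∈ toFun σ, π e = A
  isFinPlay : ∀ σ, ∀ e ∈ toFun σ, 𝓔.IsFinPlay (σ ++ [e])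

/-- The sequence `s` conforms to the strategy `S` of `A`. -/
def Conforms {𝓔 : CES E} {π : E → 𝒜} {A : 𝒜} (S : Strategy 𝓔 π A) (s : Stream'.Seq E) : Prop :=
  ∀ i e, s.get? i = some e → π e = A → e ∈ S.toFun (s.take i)

/-- The sequence `s` is fair with respect to the strategy `S`. -/
def Fair {𝓔 : CES E} {π : E → 𝒜} {A : 𝒜} (S : Strategy 𝓔 π A) (s : Stream'.Seq E) : Prop :=
  ∀ (e : E) (i : ℕ), (i : ℕ∞) ≤ s.length' →
    (∀ j : ℕ, i ≤ j → (j : ℕ∞) ≤ s.length' → e ∈ S.toFun (s.take j)) →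
    ∃ h : ℕ, i ≤ h ∧ s.get? h = some e

/-- Participant `A` is innocent in `s`, relative to a predicate `P` (where `P σ e` is read as
"`e` is prudent in `σ`"): each event of `A` is infinitely often imprudent along `s`. -/
def Innocent (π : E → 𝒜) (P : List E → E → Prop) (A : 𝒜) (s : Stream'.Seq E) : Prop :=
  ∀ e, π e = A → ∀ i : ℕ, ∃ j : ℕ, i ≤ j ∧ ¬ P (s.take j) e

/-- The strategy `S` of `A` is prudent with past `σ`, relative to `P`: `σ` conforms to `S`, and
each fair play extending `σ` which conforms to `S` and where all the other participants are
innocent honours at some point all the credits of `A`, but for those coming from `σ`. -/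
def PrudentStrategy {𝓔 : CES E} {π : E → 𝒜} (P : List E → E → Prop) {A : 𝒜}
    (S : Strategy 𝓔 π A) (σ : List E) : Prop :=
  Conforms S (Stream'.Seq.ofList σ) ∧
  ∀ s : Stream'.Seq E, 𝓔.IsPlay s → s.take σ.length = σ → Conforms S s → Fair S s →
    (∀ B, B ≠ A → Innocent π P B s) →
    ∃ k : ℕ, σ.length < k ∧ 𝓔.credit (s.take k) ∩ {e | π e = A} ⊆ 𝓔.credit σ

/-- The right-hand side of the recursive definition of prudence: `e` is prescribed in `σ` by
some strategy which is prudent with past `σ`, where innocence is computed from `P`.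
It is monotone in `P`, since `P` occurs below two negations. -/
def prudenceStep (𝓔 : CES E) (π : E → 𝒜) : (List E → E → Prop) →o (List E → E → Prop) where
  toFun P := fun σ e => ∃ (A : 𝒜) (S : Strategy 𝓔 π A), PrudentStrategy P S σ ∧ e ∈ S.toFun σ
  monotone' := by
    rintro P Q hPQ σ e ⟨A, S, ⟨hσ, hS⟩, he⟩
    refine ⟨A, S, ⟨hσ, fun s h1 h2 h3 h4 h5 => hS s h1 h2 h3 h4 ?_⟩, he⟩
    intro B hB x hx i
    obtain ⟨j, hj, hQ⟩ := h5 B hB x hx i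
    exact ⟨j, hj, fun hP => hQ (hPQ _ _ hP)⟩

/-- `P` is a solution of the mutually recursive definition of prudence and innocence. -/
def IsPrudence (𝓔 : CES E) (π : E → 𝒜) (P : List E → E → Prop) : Prop :=
  ∀ σ e, P σ e ↔ 𝓔.prudenceStep π P σ e

/-- Prudence of an event in a finite sequence: the solution of the recursive definition
for which innocence is largest (coinductive), i.e. for which prudence is smallest. -/
def Prudent (𝓔 : CES E) (π : E → 𝒜) : List E → E → Prop :=
  OrderHom.lfp (𝓔.prudenceStep π)

/-- A (finite) prudent play, relative to a notion `P` of prudence: each event is prudent in the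
prefix preceding it. -/
def IsPrudentPlay (𝓔 : CES E) (P : List E → E → Prop) (σ : List E) : Prop :=
  𝓔.IsFinPlay σ ∧ ∀ i e, σ[i]? = some e → P (σ.take i) e

end CES

/-! ### Horn PCL theories and proof traces -/

/-- Horn clauses of Propositional Contract Logic over the atoms `E`: `imp α a` is the clause
`(⋀ α) → a`, and `cimp α a` is the clause `(⋀ α) ↠ a`. The atom `a`, seen as a clause, is
`⊤ → a`, i.e. `imp ∅ a`. -/
inductive HornClause (E : Type*) where
  | imp (α : Finset E) (a : E)
  | cimp (α : Finset E) (a : E)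

open Classical in
/-- Removes duplicates from the right, i.e. keeps the leftmost occurrence of each element. -/
noncomputable def removeDups {E : Type*} : List E → List E
  | [] => []
  | a :: l => a :: (removeDups l).filter (fun x => x ≠ a)

/-- `Shuffle σ η τ`: the list `τ` is an interleaving of `σ` and `η`
(before removing duplicates). -/
inductive Shuffle {E : Type*} : List E → List E → List E → Prop
  | nil : Shuffle [] [] []
  | left (a : E) {σ η τ : List E} : Shuffle σ η τ → Shuffle (a :: σ) η (a :: τ)
  | right (a : E) {σ η τ : List E} : Shuffle σ η τ → Shuffle σ (a :: η) (a :: τ)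

/-- `ProofTrace Δ σ` means that `σ` is a proof trace of the Horn PCL theory `Δ`. -/
inductive ProofTrace {E : Type*} : Set (HornClause E) → List E → Prop
  | nil (Δ : Set (HornClause E)) : ProofTrace Δ []
  | imp {Δ : Set (HornClause E)} {α : Finset E} {a : E} {σ : List E} :
      HornClause.imp α a ∈ Δ → ProofTrace Δ σ → (∀ x ∈ α, x ∈ σ) →
      ProofTrace Δ (removeDups (σ ++ [a]))
  | cimp {Δ : Set (HornClause E)} {α : Finset E} {a : E} {σ τ : List E} :
      HornClause.cimp α a ∈ Δ → ProofTrace (insert (HornClause.imp ∅ a) Δ) σ →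
      (∀ x ∈ α, x ∈ σ) → Shuffle σ [a] τ →
      ProofTrace Δ (removeDups τ)

/-- The set of proof traces of a Horn PCL theory. -/
def proofTraces {E : Type*} (Δ : Set (HornClause E)) : Set (List E) := {σ | ProofTrace Δ σ}

/-- The correspondence `Δ ∼ 𝓔` between Horn PCL theories and conflict-free CES. -/
def TheorySim {E : Type*} (Δ : Set (HornClause E)) (𝓔 : CES E) : Prop :=
  𝓔.ConflictFree ∧
    Δ = {c | ∃ X e, 𝓔.enables X e ∧ c = HornClause.imp X e} ∪
      {c | ∃ X e, 𝓔.circEnables X e ∧ c = HornClause.cimp X e}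

/-! Prudence turns out to be the strategy-free condition `Payable`: after `l e` some finite
continuation leaves no credits except those already present in `l`. This works because, without
conflicts, enabling is monotone in the set of events: credits can be paid but never reappear, and
two continuations can be merged by appending to one the missing events of the other
(`credit_append_filter`).

A payable event is prudent for every `P` closed under the recursion step (`of_credit_subset`): its
owner `A` follows a paying continuation, and innocence makes the others do their share of it, since
those events are payable by shorter continuations.

Conversely, let `A` play a prudent strategy while the others do prudent events, all scheduled
fairly. Then `A` pays at a finite stage (`exists_play`); if the events of the others are payable,
merging their continuations pays the rest (`payable_of_play`). So `Payable` is closed under the step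
and contains the least solution. For an arbitrary solution, induction on the number of enableable
events still to be done replaces leastness.

Finally, proof traces are exactly the repetition-free sequences without credits (`proofTrace_iff`),
and merging shows that prudent plays are exactly their prefixes. -/

namespace CES

variable {E 𝒜 : Type*}

/-! ### Credits and merging of plays in a conflict-free CES -/

/-- `e` is enabled by some finite subset of the events of `l`. -/
def EnabledBy (𝓔 : CES E) (l : List E) (e : E) : Prop :=
  ∃ X, 𝓔.enables X e ∧ ∀ x ∈ X, x ∈ l

/-- `e` is circularly enabled by some finite subset of the events of `l`. -/
def CircEnabledBy (𝓔 : CES E) (l : List E) (e : E) : Prop :=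
  ∃ X, 𝓔.circEnables X e ∧ ∀ x ∈ X, x ∈ l

theorem EnabledBy.mono {𝓔 : CES E} {l m : List E} {e : E} (h : 𝓔.EnabledBy l e) (hlm : l ⊆ m) :
    𝓔.EnabledBy m e :=
  let ⟨X, hX, hl⟩ := h
  ⟨X, hX, fun x hx => hlm (hl x hx)⟩

theorem CircEnabledBy.mono {𝓔 : CES E} {l m : List E} {e : E} (h : 𝓔.CircEnabledBy l e)
    (hlm : l ⊆ m) : 𝓔.CircEnabledBy m e :=
  let ⟨X, hX, hl⟩ := h
  ⟨X, hX, fun x hx => hlm (hl x hx)⟩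

open Classical in
theorem ConflictFree.enables_toFinset_iff {𝓔 : CES E} (hc : 𝓔.ConflictFree) {l : List E} {e : E} :
    𝓔.enables l.toFinset e ↔ 𝓔.EnabledBy l e :=
  ⟨fun h => ⟨_, h, fun _ => List.mem_toFinset.1⟩, fun ⟨X, hX, hl⟩ =>
    𝓔.enables_saturated X _ e (fun x hx => List.mem_toFinset.2 (hl x hx)) hX
      fun a _ b _ => hc a b⟩

open Classical in
theorem ConflictFree.circEnables_toFinset_iff {𝓔 : CES E} (hc : 𝓔.ConflictFree) {l : List E}
    {e : E} : 𝓔.circEnables l.toFinset e ↔ 𝓔.CircEnabledBy l e :=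
  ⟨fun h => ⟨_, h, fun _ => List.mem_toFinset.1⟩, fun ⟨X, hX, hl⟩ =>
    𝓔.circEnables_saturated X _ e (fun x hx => List.mem_toFinset.2 (hl x hx)) hX
      fun a _ b _ => hc a b⟩

theorem ConflictFree.isFinPlay_iff {𝓔 : CES E} (hc : 𝓔.ConflictFree) {l : List E} :
    𝓔.IsFinPlay l ↔ l.Nodup :=
  ⟨fun h => h.1, fun h => ⟨h, fun a _ b _ => hc a b⟩⟩

theorem mem_of_mem_credit {𝓔 : CES E} {l : List E} {e : E} (h : e ∈ 𝓔.credit l) : e ∈ l := by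
  obtain ⟨i, hi, -⟩ := h
  exact List.mem_of_getElem? hi

theorem ConflictFree.mem_credit_iff {𝓔 : CES E} (hc : 𝓔.ConflictFree) {a b : List E} {e : E}
    (hn : (a ++ e :: b).Nodup) :
    e ∈ 𝓔.credit (a ++ e :: b) ↔ ¬ 𝓔.EnabledBy a e ∧ ¬ 𝓔.CircEnabledBy (a ++ e :: b) e := by
  simp only [credit, Set.mem_ofPred_eq, hc.enables_toFinset_iff, hc.circEnables_toFinset_iff]
  constructor
  · rintro ⟨i, hi, h⟩
    obtain ⟨hi', hi⟩ := List.getElem?_eq_some_iff.1 hi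
    have : i = a.length := by
      refine (List.Nodup.getElem_inj_iff hn (hi := hi') (hj := by simp)).1 ?_
      rw [hi]; simp
    subst this
    simpa using h
  · intro h
    exact ⟨a.length, by simp, by simpa using h⟩

/-- The past of an event of `l` is the same in `l` and `m`, while circular enablings only grow:
extending a play creates no credit among old events. -/
theorem ConflictFree.mem_credit_of_prefix {𝓔 : CES E} (hc : 𝓔.ConflictFree) {l m : List E} {e : E}
    (hn : m.Nodup) (hlm : l <+: m) (he : e ∈ 𝓔.credit m) (hl : e ∈ l) : e ∈ 𝓔.credit l := by
  obtain ⟨t, rfl⟩ := hlm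
  obtain ⟨a, b, rfl⟩ := List.append_of_mem hl
  have hn' := (List.nodup_append.1 hn).1
  rw [hc.mem_credit_iff hn']
  have hs : a ++ e :: b ++ t = a ++ e :: (b ++ t) := by simp
  rw [hs] at hn he
  rw [hc.mem_credit_iff hn] at he
  exact ⟨he.1, fun h => he.2 (h.mono (by rw [← hs]; exact List.subset_append_left _ _))⟩

open Classical in
/-- Appending to `m` the missing events of an extension `l` of one of its prefixes, where `l`
makes no credit of its own, creates no credits. -/
theorem ConflictFree.credit_append_filter {𝓔 : CES E} (hc : 𝓔.ConflictFree) {p l m : List E}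
    (hm : m.Nodup) (hl : l.Nodup) (hpm : p ⊆ m) (hcr : 𝓔.credit l ⊆ 𝓔.credit p) :
    (m ++ l.filter (· ∉ m)).Nodup ∧ 𝓔.credit (m ++ l.filter (· ∉ m)) ⊆ 𝓔.credit m := by
  have hn : (m ++ l.filter (· ∉ m)).Nodup := by
    refine List.nodup_append.2 ⟨hm, hl.filter _, fun a ha b hb => ?_⟩
    rintro rfl
    simp at hb
    exact hb.2 ha
  refine ⟨hn, fun x hx => ?_⟩
  by_cases hxm : x ∈ m
  · exact hc.mem_credit_of_prefix hn (List.prefix_append _ _) hx hxm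
  exfalso
  have hxl : x ∈ l := by
    have := mem_of_mem_credit hx
    simp [hxm] at this
    exact this
  -- A new event `x` is not a credit of `l`; after merging, both its past and the whole sequence
  -- contain those it had in `l`, so its enabling survives.
  obtain ⟨a, b, rfl⟩ := List.append_of_mem hxl
  have hnc : x ∉ 𝓔.credit (a ++ x :: b) := fun h => hxm (hpm (mem_of_mem_credit (hcr h)))
  rw [hc.mem_credit_iff hl] at hnc
  have hs : m ++ (a ++ x :: b).filter (· ∉ m) =
      (m ++ a.filter (· ∉ m)) ++ x :: b.filter (· ∉ m) := by
    simp [hxm]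
  have hsub : ∀ c : List E, c ⊆ m ++ c.filter (· ∉ m) := by
    intro c y hy
    by_cases y ∈ m <;> simp_all
  have hsub' := hsub (a ++ x :: b)
  rw [hs] at hn hx hsub'
  rw [hc.mem_credit_iff hn] at hx
  exact hnc ⟨fun h => hx.1 (h.mono (hsub a)), fun h => hx.2 (h.mono hsub')⟩

theorem ConflictFree.exists_credit_subset {𝓔 : CES E} (hc : 𝓔.ConflictFree) {p l m : List E}
    (hm : m.Nodup) (hl : l.Nodup) (hpm : p ⊆ m) (hcr : 𝓔.credit l ⊆ 𝓔.credit p) :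
    ∃ m', m'.Nodup ∧ m <+: m' ∧ l ⊆ m' ∧ 𝓔.credit m' ⊆ 𝓔.credit m := by
  classical
  obtain ⟨h1, h2⟩ := hc.credit_append_filter hm hl hpm hcr
  refine ⟨_, h1, List.prefix_append _ _, fun y hy => ?_, h2⟩
  by_cases y ∈ m <;> simp_all

/-- Each event of `l` is in `Y`, or is enabled when first done, or is circularly enabled. -/
def Justified (𝓔 : CES E) (Y : Set E) (l : List E) : Prop :=
  ∀ a e b, l = a ++ e :: b → e ∉ a → e ∈ Y ∨ 𝓔.EnabledBy a e ∨ 𝓔.CircEnabledBy l e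

theorem ConflictFree.justified_empty_iff {𝓔 : CES E} (hc : 𝓔.ConflictFree) {l : List E}
    (hl : l.Nodup) : 𝓔.Justified ∅ l ↔ 𝓔.credit l = ∅ := by
  constructor
  · intro h
    refine Set.eq_empty_of_forall_notMem fun e he => ?_
    obtain ⟨a, b, rfl⟩ := List.append_of_mem (mem_of_mem_credit he)
    have hea : e ∉ a := fun hea => by
      rw [List.nodup_append] at hl
      exact hl.2.2 e hea e (by simp) rfl
    rw [hc.mem_credit_iff hl] at he
    have := h a e b rfl hea
    simp only [Set.mem_empty_iff_false, false_or] at this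
    tauto
  · rintro h a e b rfl -
    have : e ∉ 𝓔.credit (a ++ e :: b) := by simp [h]
    rw [hc.mem_credit_iff hl] at this
    tauto

end CES

/-! ### Proof traces as credit-free sequences -/

section Traces

variable {E : Type*}

theorem mem_removeDups {l : List E} {x : E} : x ∈ removeDups l ↔ x ∈ l := by
  induction l with
  | nil => simp [removeDups]
  | cons h t ih =>
    by_cases hx : x = h <;> simp [removeDups, ih, hx]

theorem nodup_removeDups (l : List E) : (removeDups l).Nodup := by
  induction l with
  | nil => simp [removeDups]
  | cons h t ih =>
    simp only [removeDups, List.nodup_cons]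
    exact ⟨by simp, ih.filter _⟩

open Classical in
theorem removeDups_append_singleton {l : List E} (hl : l.Nodup) {x : E} :
    (x ∈ l → removeDups (l ++ [x]) = l) ∧ (x ∉ l → removeDups (l ++ [x]) = l ++ [x]) := by
  induction l with
  | nil => simp [removeDups]
  | cons h t ih =>
    rw [List.nodup_cons] at hl
    have hf : t.filter (fun y => decide (y ≠ h)) = t :=
      List.filter_eq_self.2 fun y hy => by simpa using ne_of_mem_of_not_mem hy hl.1
    obtain ⟨ih1, ih2⟩ := ih hl.2
    constructor
    · intro hx
      simp only [List.cons_append, removeDups, List.cons.injEq, true_and]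
      by_cases hxt : x ∈ t
      · rw [ih1 hxt]
        convert hf
      · have : x = h := by simpa [hxt] using hx
        subst this
        rw [ih2 hxt, List.filter_append]
        simp only [ne_eq, not_true_eq_false, decide_false, Bool.false_eq_true,
          not_false_eq_true, List.filter_cons_of_neg, List.filter_nil, List.append_nil]
        convert hf
    · intro hx
      simp only [List.mem_cons, not_or] at hx
      simp only [List.cons_append, removeDups, List.cons.injEq, true_and]
      rw [ih2 hx.2, List.filter_append]
      have h1 : [x].filter (fun y => decide (y ≠ h)) = [x] := by simp [hx.1]
      convert congrArg₂ (· ++ ·) hf h1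

/-- Keeping leftmost occurrences loses nothing from the past of a first occurrence; this is why
justifications survive the removal of duplicates. -/
theorem exists_of_removeDups_eq {l : List E} :
    ∀ {a b : List E} {x : E}, removeDups l = a ++ x :: b →
      ∃ a' b', l = a' ++ x :: b' ∧ x ∉ a' ∧ a' ⊆ a := by
  induction l with
  | nil => simp [removeDups]
  | cons h t ih =>
    intro a b x hx
    rw [removeDups] at hx
    cases a with
    | nil =>
      simp only [List.nil_append, List.cons.injEq] at hx
      exact ⟨[], t, by simp [hx.1], by simp, by simp⟩
    | cons h' a =>
      simp only [List.cons_append, List.cons.injEq] at hx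
      obtain ⟨rfl, hx⟩ := hx
      have hxh : x ≠ h := by
        have : x ∈ a ++ x :: b := by simp
        rw [← hx] at this
        simpa using (List.mem_filter.1 this).2
      obtain ⟨l₁, l₂, hl, rfl, hl₂⟩ := List.filter_eq_append_iff.1 hx
      obtain ⟨l₃, l₄, rfl, h₃, -, -⟩ := List.filter_eq_cons_iff.1 hl₂
      rw [← List.append_assoc] at hl
      obtain ⟨a', b', rfl, hxa, hsub⟩ := ih hl
      refine ⟨h :: a', b', by simp, by simp [hxh, hxa], ?_⟩
      intro y hy
      by_cases hyh : y = h
      · simp [hyh]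
      have hya : y ∈ a' := by simpa [hyh] using hy
      have := hsub hya
      rw [List.mem_append] at this
      rcases this with h' | h'
      · simp [h', hyh]
      · exact absurd (by simpa using h₃ y h') hyh

theorem Shuffle.exists_append {l m n : List E} (h : Shuffle l m n) :
    (m = [] → n = l) ∧ ∀ x, m = [x] → ∃ p q, l = p ++ q ∧ n = p ++ x :: q := by
  induction h with
  | nil => simp
  | left a h ih =>
    refine ⟨fun hm => by rw [ih.1 hm], fun x hx => ?_⟩
    obtain ⟨p, q, rfl, rfl⟩ := ih.2 x hx
    exact ⟨a :: p, q, rfl, rfl⟩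
  | right a h ih =>
    refine ⟨by simp, fun x hx => ?_⟩
    simp only [List.cons.injEq] at hx
    exact ⟨[], _, rfl, by simp [ih.1 hx.2, hx.1]⟩

theorem Shuffle.append_singleton (l : List E) (x : E) : Shuffle l [x] (l ++ [x]) := by
  induction l with
  | nil => exact .right x .nil
  | cons h t ih => exact .left h ih

/-- The theory of a CES, extended with the atoms in `Y`. -/
def CES.theoryWith (𝓔 : CES E) (Y : Set E) : Set (HornClause E) :=
  {c | ∃ X e, 𝓔.enables X e ∧ c = HornClause.imp X e} ∪
    {c | ∃ X e, 𝓔.circEnables X e ∧ c = HornClause.cimp X e} ∪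
    {c | ∃ e ∈ Y, c = HornClause.imp ∅ e}

theorem CES.insert_theoryWith (𝓔 : CES E) (Y : Set E) (e : E) :
    insert (HornClause.imp ∅ e) (𝓔.theoryWith Y) = 𝓔.theoryWith (insert e Y) := by
  ext c
  simp only [CES.theoryWith, Set.mem_insert_iff, Set.mem_union, Set.mem_ofPred_eq,
    exists_eq_or_imp]
  exact or_left_comm

theorem CES.Justified.removeDups {𝓔 : CES E} {Y : Set E} {l : List E} (h : 𝓔.Justified Y l) :
    𝓔.Justified Y (removeDups l) := by
  intro a e b hab _
  obtain ⟨a', b', hl, hea, hsub⟩ := exists_of_removeDups_eq hab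
  rcases h a' e b' hl hea with h | h | h
  · exact .inl h
  · exact .inr (.inl (h.mono hsub))
  · exact .inr (.inr (h.mono fun x hx => mem_removeDups.2 hx))

theorem ProofTrace.nodup {Δ : Set (HornClause E)} {l : List E} (h : ProofTrace Δ l) : l.Nodup := by
  cases h with
  | nil => simp
  | imp => exact nodup_removeDups _
  | cimp => exact nodup_removeDups _

/-- The set `Y` of assumed atoms must vary in the induction, because the rule for `↠` derives its
premise with one more atom. That atom is then justified circularly by the trace itself. -/
theorem ProofTrace.justified {𝓔 : CES E} {Δ : Set (HornClause E)} {l : List E}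
    (h : ProofTrace Δ l) : ∀ Y, Δ = 𝓔.theoryWith Y → 𝓔.Justified Y l := by
  induction h with
  | nil => intro Y _ a e b h; simp at h
  | @imp Δ α x σ hx _ hα ih =>
    rintro Y rfl
    refine CES.Justified.removeDups ?_
    intro a e b hab hea
    rcases List.eq_nil_or_concat b with rfl | ⟨b, y, rfl⟩
    · obtain ⟨rfl, he⟩ := List.append_inj' hab rfl
      simp only [List.cons.injEq, and_true] at he
      subst he
      rcases hx with (⟨X, e, h, heq⟩ | ⟨X, e, h, heq⟩) | ⟨e, h, heq⟩
      · cases heq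
        exact .inr (.inl ⟨α, h, hα⟩)
      · cases heq
      · cases heq
        exact .inl h
    · have hab' : σ ++ [x] = (a ++ e :: b) ++ [y] := by simpa using hab
      obtain ⟨rfl, -⟩ := List.append_inj' hab' rfl
      rcases ih Y rfl a e b rfl hea with h | h | h
      · exact .inl h
      · exact .inr (.inl h)
      · exact .inr (.inr (h.mono (List.subset_append_left _ _)))
  | @cimp Δ α x σ τ hx _ hα hs ih =>
    rintro Y rfl
    refine CES.Justified.removeDups ?_
    obtain ⟨p, q, rfl, rfl⟩ := hs.exists_append.2 x rfl
    have hsub : p ++ q ⊆ p ++ x :: q := by intro y; simp; tauto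
    intro a e b hab hea
    by_cases hex : e = x
    · subst hex
      rcases hx with (⟨X, e', h, heq⟩ | ⟨X, e', h, heq⟩) | ⟨e', h, heq⟩
      · cases heq
      · cases heq
        exact .inr (.inr ⟨α, h, fun y hy => hsub (hα y hy)⟩)
      · cases heq
    have key : ∃ a' b', p ++ q = a' ++ e :: b' ∧ a' ⊆ a := by
      rcases List.append_eq_append_iff.1 hab with ⟨c, rfl, hc⟩ | ⟨c, rfl, hc⟩
      · cases c with
        | nil =>
          simp only [List.nil_append, List.cons.injEq] at hc
          exact absurd hc.1.symm hex
        | cons y c =>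
          simp only [List.cons_append, List.cons.injEq] at hc
          obtain ⟨rfl, rfl⟩ := hc
          exact ⟨p ++ c, b, by simp, by intro z; simp; tauto⟩
      · cases c with
        | nil =>
          simp only [List.nil_append, List.cons.injEq] at hc
          exact absurd hc.1 hex
        | cons y c =>
          simp only [List.cons_append, List.cons.injEq] at hc
          obtain ⟨rfl, rfl⟩ := hc
          exact ⟨a, c ++ q, by simp, List.Subset.refl _⟩
    obtain ⟨a', b', hpq, ha⟩ := key
    rcases ih _ (𝓔.insert_theoryWith Y x) a' e b' hpq (fun h => hea (ha h)) with h | h | h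
    · exact .inl (h.resolve_left hex)
    · exact .inr (.inl (h.mono ha))
    · exact .inr (.inr (h.mono hsub))

theorem CES.ConflictFree.proofTrace_iff {𝓔 : CES E} (hc : 𝓔.ConflictFree) {l : List E} :
    ProofTrace (𝓔.theoryWith ∅) l ↔ l.Nodup ∧ 𝓔.credit l = ∅ := by
  classical
  constructor
  · intro h
    exact ⟨h.nodup, (hc.justified_empty_iff h.nodup).1 (h.justified _ rfl)⟩
  rintro ⟨hl, hcr⟩
  have hj := (hc.justified_empty_iff hl).2 hcr
  -- Assume as atoms all circularly enabled events of `l`; then `l` is derived event by event with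
  -- `→` clauses only.
  have hbase : ∀ p, p <+: l →
      ProofTrace (𝓔.theoryWith ↑(l.toFinset.filter (𝓔.CircEnabledBy l))) p := by
    intro p
    induction p using List.reverseRecOn with
    | nil => exact fun _ => .nil _
    | append_singleton p x ih =>
      intro hp
      have hpn : (p ++ [x]).Nodup := hp.sublist.nodup hl
      have hxp : x ∉ p := by
        intro h
        exact (List.nodup_append.1 hpn).2.2 x h x (by simp) rfl
      have hp' := ih ((List.prefix_append p [x]).trans hp)
      rw [← (removeDups_append_singleton hp'.nodup).2 hxp]
      obtain ⟨t, ht⟩ := hp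
      rcases hj p x t (by simp [← ht]) hxp with h | ⟨X, h, hX⟩ | h
      · simp at h
      · exact .imp (α := X) (.inl (.inl ⟨X, x, h, rfl⟩)) hp' hX
      · refine .imp (α := ∅) (.inr ⟨x, ?_, rfl⟩) hp' (by simp)
        exact Finset.mem_coe.2 (Finset.mem_filter.2 ⟨by simp [← ht], h⟩)
  -- The assumed atoms are discharged one at a time by `↠`. Each already occurs in `l`, so
  -- interleaving it at the end and deleting duplicates leaves `l` unchanged.
  have hpeel : ∀ Y : Finset E, (∀ y ∈ Y, y ∈ l ∧ 𝓔.CircEnabledBy l y) →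
      ProofTrace (𝓔.theoryWith ↑Y) l → ProofTrace (𝓔.theoryWith ∅) l := by
    intro Y
    induction Y using Finset.induction_on with
    | empty => intro _ h; simpa using h
    | insert y Y _ ih =>
      intro hY h
      refine ih (fun z hz => hY z (Finset.mem_insert_of_mem hz)) ?_
      obtain ⟨hy, X, hX, hXl⟩ := hY y (Finset.mem_insert_self _ _)
      rw [Finset.coe_insert, ← CES.insert_theoryWith] at h
      rw [← (removeDups_append_singleton hl).1 hy]
      exact .cimp (.inl (.inr ⟨X, y, hX, rfl⟩)) h hXl (Shuffle.append_singleton l y)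
  exact hpeel _ (by simp) (hbase l (List.prefix_refl _))

theorem TheorySim.mem_proofTraces_iff {Δ : Set (HornClause E)} {𝓔 : CES E} (h : TheorySim Δ 𝓔)
    {l : List E} : l ∈ proofTraces Δ ↔ l.Nodup ∧ 𝓔.credit l = ∅ := by
  have : Δ = 𝓔.theoryWith ∅ := by
    rw [h.2]
    simp [CES.theoryWith]
  rw [proofTraces, Set.mem_ofPred_eq, this, h.1.proofTrace_iff]

end Traces

/-! ### Prefixes of finite and infinite sequences -/

section SeqTake

variable {E : Type*}

theorem Stream'.Seq.take_take_of_le (s : Stream'.Seq E) {m n : ℕ} (h : m ≤ n) :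
    (s.take n).take m = s.take m := by
  refine List.ext_getElem? fun i => ?_
  rw [List.getElem?_take, Stream'.Seq.getElem?_take, Stream'.Seq.getElem?_take]
  by_cases hi : i < m
  · simp [hi, hi.trans_le h]
  · simp [hi]

theorem Stream'.Seq.take_prefix_take (s : Stream'.Seq E) {m n : ℕ} (h : m ≤ n) :
    s.take m <+: s.take n := by
  rw [← s.take_take_of_le h]
  exact List.take_prefix _ _

theorem Stream'.Seq.mem_take_iff {s : Stream'.Seq E} {n : ℕ} {x : E} :
    x ∈ s.take n ↔ ∃ h < n, s.get? h = some x := by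
  constructor
  · intro hx
    obtain ⟨i, hi⟩ := List.mem_iff_getElem?.1 hx
    rw [Stream'.Seq.getElem?_take] at hi
    split_ifs at hi with h
    exact ⟨i, h, hi⟩
  · rintro ⟨h, hn, hx⟩
    exact Stream'.Seq.get?_mem_take hn hx

theorem Stream'.Seq.take_succ_of_get? {s : Stream'.Seq E} {n : ℕ} {x : E} (h : s.get? n = some x) :
    s.take (n + 1) = s.take n ++ [x] := by
  conv_lhs => rw [← s.take_take_of_le le_rfl, List.take_add_one]
  rw [s.take_take_of_le n.le_succ, Stream'.Seq.getElem?_take]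
  simp [h]

theorem Stream'.Seq.take_ofList (l : List E) (n : ℕ) : (Stream'.Seq.ofList l).take n = l.take n := by
  refine List.ext_getElem? fun i => ?_
  rw [List.getElem?_take, Stream'.Seq.getElem?_take, Stream'.Seq.ofList_get?]

theorem Stream'.Seq.take_eq_take_of_terminatedAt {s : Stream'.Seq E} {m n : ℕ}
    (h : s.get? m = none) (hmn : m ≤ n) : s.take n = s.take m := by
  refine List.ext_getElem? fun i => ?_
  rw [Stream'.Seq.getElem?_take, Stream'.Seq.getElem?_take]
  by_cases hi : i < m
  · simp [hi, hi.trans_le hmn]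
  · simp [hi, s.le_stable (not_lt.1 hi) h]

theorem Stream'.Seq.exists_subset_take {s : Stream'.Seq E} {l : List E}
    (h : ∀ x ∈ l, ∃ i, s.get? i = some x) : ∃ n, ∀ m, n ≤ m → l ⊆ s.take m := by
  induction l with
  | nil => exact ⟨0, by simp⟩
  | cons x l ih =>
    obtain ⟨n, hn⟩ := ih fun y hy => h y (List.mem_cons_of_mem _ hy)
    obtain ⟨i, hi⟩ := h x (by simp)
    refine ⟨max n (i + 1), fun m hm => List.cons_subset.2 ⟨?_, hn m (by omega)⟩⟩
    exact Stream'.Seq.get?_mem_take (by omega) hi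

theorem List.exists_first_not {p : E → Prop} {l : List E} (h : ¬ ∀ x ∈ l, p x) :
    ∃ a x b, l = a ++ x :: b ∧ ¬ p x ∧ ∀ y ∈ a, p y := by
  induction l with
  | nil => simp at h
  | cons x l ih =>
    by_cases hx : p x
    · obtain ⟨a, y, b, rfl, hy, ha⟩ := ih (by simpa [hx] using h)
      exact ⟨x :: a, y, b, rfl, hy, by simpa [hx] using ha⟩
    · exact ⟨[], x, l, rfl, hx, by simp⟩

end SeqTake

/-! ### Payable events are prudent -/

namespace CES

variable {E 𝒜 : Type*} {𝓔 : CES E} {π : E → 𝒜}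

theorem ConflictFree.isPlay_iff (hc : 𝓔.ConflictFree) {s : Stream'.Seq E} :
    𝓔.IsPlay s ↔ ∀ n, (s.take n).Nodup := by
  constructor
  · intro h n
    refine List.nodup_iff_injective_get.2 fun i j hij => Fin.ext (h.1 i j ((s.take n).get i) ?_ ?_)
    · have hi := List.getElem?_eq_getElem i.2
      rw [Stream'.Seq.getElem?_take] at hi
      split_ifs at hi
      exact hi
    · have hj := List.getElem?_eq_getElem j.2
      rw [Stream'.Seq.getElem?_take] at hj
      split_ifs at hj
      exact hj.trans (congrArg some hij.symm)
  · refine fun h => ⟨fun i j e hi hj => ?_, fun a _ b _ => hc a b⟩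
    have hi' : (s.take (max i j + 1))[i]? = some e := by
      rw [Stream'.Seq.getElem?_take, if_pos (by omega), hi]
    have hj' : (s.take (max i j + 1))[j]? = some e := by
      rw [Stream'.Seq.getElem?_take, if_pos (by omega), hj]
    obtain ⟨h1, h1'⟩ := List.getElem?_eq_some_iff.1 hi'
    obtain ⟨h2, h2'⟩ := List.getElem?_eq_some_iff.1 hj'
    exact (h _).getElem_inj_iff.1 (h1'.trans h2'.symm)

/-- If `i` lies beyond the end of `s`, fairness is applied at the length of `s` instead: all later
prefixes equal the full sequence. -/
theorem Fair.exists_get? {A : 𝒜} {S : Strategy 𝓔 π A} {s : Stream'.Seq E} (hs : Fair S s) {e : E}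
    {i : ℕ} (h : ∀ j, i ≤ j → e ∈ S.toFun (s.take j)) : ∃ h, s.get? h = some e := by
  by_cases hi : (i : ℕ∞) ≤ s.length'
  · obtain ⟨k, -, hk⟩ := hs e i hi fun j hj _ => h j hj
    exact ⟨k, hk⟩
  · rw [not_le] at hi
    obtain ⟨n, hn⟩ := ENat.ne_top_iff_exists.1 (ne_top_of_lt hi)
    rw [← hn, Nat.cast_lt] at hi
    have ht : s.get? n = none := Stream'.Seq.length'_le_iff.1 hn.ge
    obtain ⟨k, -, hk⟩ := hs e n hn.le fun j hj hj' => by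
      rw [← hn, Nat.cast_le] at hj'
      have : j = n := le_antisymm hj' hj
      rw [this, ← Stream'.Seq.take_eq_take_of_terminatedAt ht hi.le]
      exact h i le_rfl
    exact ⟨k, hk⟩

/-- The event `e` can be done after `l` in such a way that, by continuing suitably, no credits are
left but for those coming from `l`. -/
def Payable (𝓔 : CES E) (l : List E) (e : E) : Prop :=
  ∃ m : List E, m.Nodup ∧ l ++ [e] <+: m ∧ 𝓔.credit m ⊆ 𝓔.credit l

open Classical in
/-- The strategy of `A` that, after `l`, does the enabled events among those of `m`. -/
noncomputable def payStrategy (hc : 𝓔.ConflictFree) (π : E → 𝒜) (A : 𝒜) (l m : List E) :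
    Strategy 𝓔 π A where
  toFun p := {x | π x = A ∧ (p ++ [x]).Nodup ∧
    -- The first alternative replays `l`, so that the past conforms to the strategy.
    (p ++ [x] <+: l ∨ l <+: p ∧ x ∈ m ∧ (𝓔.EnabledBy p x ∨ 𝓔.CircEnabledBy m x))}
  owner _ _ h := h.1
  isFinPlay _ _ h := hc.isFinPlay_iff.2 h.2.1

/-- Induction on the length of the continuation `b`. It suffices that every fair play against
innocent opponents does all of `l e b`. Let `f` be the first event never done. If `A` owns `f`, the
strategy prescribes it from some point on, against fairness. Otherwise `f` and the remaining missing
events form a shorter continuation at all late stages, so `f` is prudent there, against innocence.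
-/
theorem ConflictFree.of_credit_subset (hc : 𝓔.ConflictFree) (π : E → 𝒜) {P : List E → E → Prop}
    (hP : 𝓔.prudenceStep π P ≤ P) (n : ℕ) : ∀ {l b : List E} {e : E}, b.length ≤ n →
      (l ++ e :: b).Nodup → 𝓔.credit (l ++ e :: b) ⊆ 𝓔.credit l → P l e := by
  classical
  induction n using Nat.strong_induction_on with | _ n ih
  intro l b e hb hn hcr
  have hl : l.Nodup := (List.nodup_append.1 hn).1
  refine hP l e ⟨π e, payStrategy hc π (π e) l (l ++ e :: b), ⟨?_, ?_⟩, ?_⟩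
  · intro i x hx hxA
    refine ⟨hxA, ?_⟩
    rw [← Stream'.Seq.take_succ_of_get? hx, Stream'.Seq.take_ofList]
    exact ⟨hl.sublist (List.take_sublist _ _), .inl (List.take_prefix _ _)⟩
  · intro s hs hsl hconf hfair hinn
    rw [hc.isPlay_iff] at hs
    have hls : ∀ j, l.length ≤ j → l <+: s.take j := fun j hj => by
      rw [← hsl]
      exact s.take_prefix_take (by simpa [hsl] using hj)
    have hlget : ∀ x ∈ l, ∃ i, s.get? i = some x := fun x hx => by
      obtain ⟨i, -, hi⟩ := Stream'.Seq.mem_take_iff.1 ((hls _ le_rfl).subset hx)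
      exact ⟨i, hi⟩
    have hall : ∀ x ∈ l ++ e :: b, ∃ i, s.get? i = some x := by
      by_contra hnot
      obtain ⟨a, f, c, heq, hf, ha⟩ := List.exists_first_not hnot
      obtain ⟨N, hN⟩ := Stream'.Seq.exists_subset_take ha
      have hfs : ∀ j, f ∉ s.take j := fun j hj => by
        obtain ⟨i, -, hi⟩ := Stream'.Seq.mem_take_iff.1 hj
        exact hf ⟨i, hi⟩
      have hfl : f ∉ l := fun h => hf (hlget f h)
      have hfc : f ∉ 𝓔.credit (l ++ e :: b) := fun h => hfl (mem_of_mem_credit (hcr h))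
      have hnod : ∀ j, (s.take j ++ [f]).Nodup := fun j =>
        List.nodup_append.2 ⟨hs j, by simp, fun x hx y hy => by
          rintro rfl
          simp only [List.mem_singleton] at hy
          exact hfs j (hy ▸ hx)⟩
      by_cases hfA : π f = π e
      · refine hf (hfair.exists_get? (i := max N l.length) fun j hj =>
          ⟨hfA, hnod j, .inr ⟨hls j (by omega), by simp [heq], ?_⟩⟩)
        have hn' := hn
        rw [heq] at hn' hfc
        rw [hc.mem_credit_iff hn', not_and_or, not_not, not_not] at hfc
        rw [heq]
        exact hfc.imp (fun h => h.mono (hN j (by omega))) id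
      · obtain ⟨j, hj, hPj⟩ := hinn (π f) hfA f rfl (max N l.length)
        apply hPj
        have hn' := hc.credit_append_filter (hs j) hn (hls j (by omega)).subset hcr
        have haf : a.filter (· ∉ s.take j) = [] := by
          simpa using fun x hx => hN j (by omega) hx
        have hsplit : (l ++ e :: b).filter (· ∉ s.take j) = f :: c.filter (· ∉ s.take j) := by
          rw [heq, List.filter_append, haf]
          simp [hfs j]
        -- `f` is neither in `l` nor equal to `e`, having another owner, so `e` precedes it and is
        -- already done.
        have he : e ∈ s.take j := by
          refine hN j (by omega) ?_
          rcases List.append_eq_append_iff.1 heq with ⟨d, rfl, hd⟩ | ⟨d, rfl, hd⟩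
          · cases d with
            | nil =>
              simp only [List.nil_append, List.cons.injEq] at hd
              exact absurd (congrArg π hd.1.symm) hfA
            | cons y d =>
              simp only [List.cons_append, List.cons.injEq] at hd
              simp [hd.1]
          · cases d with
            | nil =>
              simp only [List.nil_append, List.cons.injEq] at hd
              exact absurd (congrArg π hd.1) hfA
            | cons y d =>
              simp only [List.cons_append, List.cons.injEq] at hd
              exact absurd (by simp [hd.1]) hfl
        -- `e` is filtered out and `f` becomes the head, so the new tail is strictly shorter than
        -- `b`.
        have hlen : (c.filter (· ∉ s.take j)).length < n := by
          have h1 : (l ++ e :: b).filter (· ∉ s.take j) = b.filter (· ∉ s.take j) := by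
            rw [List.filter_append]
            have : l.filter (· ∉ s.take j) = [] := by
              simpa using fun x hx => (hls j (by omega)).subset hx
            rw [this, List.nil_append, List.filter_cons_of_neg (by simpa using he)]
          have h2 := List.length_filter_le (· ∉ s.take j) b
          rw [← h1, hsplit, List.length_cons] at h2
          omega
        rw [hsplit] at hn'
        exact ih _ hlen le_rfl hn'.1 hn'.2
    obtain ⟨N, hN⟩ := Stream'.Seq.exists_subset_take hall
    refine ⟨max N (l.length + 1), by omega, ?_⟩
    rintro x ⟨hx, hxA⟩
    by_cases hxl : x ∈ l
    · exact hc.mem_credit_of_prefix (hs _) (hls _ (by omega)) hx hxl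
    exfalso
    obtain ⟨i, hi, hix⟩ := Stream'.Seq.mem_take_iff.1 (mem_of_mem_credit hx)
    obtain ⟨-, -, h⟩ := hconf i x hix hxA
    obtain ⟨t, ht⟩ := s.take_prefix_take (Nat.succ_le_of_lt hi)
    rw [Nat.succ_eq_add_one, Stream'.Seq.take_succ_of_get? hix, List.append_assoc,
      List.singleton_append] at ht
    have hns := hs (max N (l.length + 1))
    rw [← ht] at hx hns
    rw [hc.mem_credit_iff hns, ht] at hx
    rcases h with h | ⟨-, -, h | h⟩
    · exact hxl (h.subset (by simp))
    · exact hx.1 h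
    · exact hx.2 (h.mono (hN _ (by omega)))
  · refine ⟨rfl, ?_, .inr ⟨List.prefix_refl _, by simp, ?_⟩⟩
    · refine hn.sublist ?_
      simp
    · have hel : e ∉ l := fun h => (List.nodup_append.1 hn).2.2 e h e (by simp) rfl
      have : e ∉ 𝓔.credit (l ++ e :: b) := fun h => hel (mem_of_mem_credit (hcr h))
      rwa [hc.mem_credit_iff hn, not_and_or, not_not, not_not] at this

theorem ConflictFree.payable_le (hc : 𝓔.ConflictFree) {P : List E → E → Prop}
    (hP : 𝓔.prudenceStep π P ≤ P) {l : List E} {e : E} (h : 𝓔.Payable l e) : P l e := by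
  obtain ⟨m, hm, ⟨b, rfl⟩, hcr⟩ := h
  rw [List.append_assoc, List.singleton_append] at hm hcr
  exact hc.of_credit_subset π hP _ le_rfl hm hcr

end CES

/-! ### Fair scheduling -/

section Schedule

variable {E : Type*}

theorem Stream'.Seq.take_succ_eq (s : Stream'.Seq E) (n : ℕ) :
    s.take (n + 1) = s.take n ++ (s.get? n).toList := by
  conv_lhs => rw [← s.take_take_of_le le_rfl, List.take_add_one]
  rw [s.take_take_of_le n.le_succ, Stream'.Seq.getElem?_take]
  simp

theorem Stream'.Seq.exists_get?_eq (N : List E → Option E) :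
    ∃ s : Stream'.Seq E, ∀ n, s.get? n = N (s.take n) := by
  let L : ℕ → List E := Nat.rec [] fun _ l => l ++ (N l).toList
  have hL : ∀ n, L (n + 1) = L n ++ (N (L n)).toList := fun _ => rfl
  -- Once `N` returns `none` the list stays constant, so `N` keeps returning `none`, as a `Seq`
  -- requires.
  let s : Stream'.Seq E := ⟨fun n => N (L n), fun {n} hn => by
    have : N (L n) = none := hn
    change N (L (n + 1)) = none
    rw [hL, this]
    simpa using this⟩
  have hs : ∀ n, s.get? n = N (L n) := fun _ => rfl
  have hsL : ∀ n, s.take n = L n := by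
    intro n
    induction n with
    | zero => simp [L]
    | succ n ih => rw [Stream'.Seq.take_succ_eq, ih, hs, hL]
  exact ⟨s, fun n => by rw [hsL, hs]⟩

/-- Fair scheduling: starting from `l₀`, the events allowed by `T` can be scheduled so that no
event is allowed forever from some point on. -/
theorem exists_fair_seq [Countable E] (T : List E → Set E)
    (hT : ∀ l, ∀ x ∈ T l, (l ++ [x]).Nodup) {l₀ : List E} (hl₀ : l₀.Nodup) :
    ∃ s : Stream'.Seq E, s.take l₀.length = l₀ ∧ (∀ n, (s.take n).Nodup) ∧
      (∀ i x, l₀.length ≤ i → s.get? i = some x → x ∈ T (s.take i)) ∧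
      ∀ x i, ∃ j, i ≤ j ∧ x ∉ T (s.take j) := by
  obtain ⟨c, hcinj⟩ := exists_injective_nat E
  -- Copy `l₀` first; afterwards pick the allowed event with least code.
  have hsel : ∀ l : List E, ∃ o : Option E, (l.length < l₀.length → o = l₀[l.length]?) ∧
      (l₀.length ≤ l.length → (∀ x, o = some x → x ∈ T l) ∧
        ∀ x ∈ T l, ∃ y, o = some y ∧ c y ≤ c x) := by
    intro l
    by_cases hl : l.length < l₀.length
    · exact ⟨_, fun _ => rfl, fun h => absurd hl (not_lt.2 h)⟩
    by_cases hne : (T l).Nonempty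
    · refine ⟨some (Function.argminOn c (T l) hne), fun h => absurd h hl, fun _ => ⟨?_, ?_⟩⟩
      · rintro x hx
        cases hx
        exact Function.argminOn_mem c _ hne
      · exact fun x hx => ⟨_, rfl, Function.argminOn_le c _ hx⟩
    · exact ⟨none, fun h => absurd h hl, fun _ => ⟨by simp, fun x hx => absurd ⟨x, hx⟩ hne⟩⟩
  choose N hN₁ hN₂ using hsel
  obtain ⟨s, hs⟩ := Stream'.Seq.exists_get?_eq N
  have hpre : ∀ n, n ≤ l₀.length → s.take n = l₀.take n := by
    intro n
    induction n with
    | zero => simp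
    | succ n ih =>
      intro hn
      have hlen : (l₀.take n).length = n := by simp; omega
      rw [Stream'.Seq.take_succ_eq, hs, ih (by omega), hN₁ _ (by omega), hlen, List.take_add_one]
  have hs₀ : s.take l₀.length = l₀ := by rw [hpre _ le_rfl, List.take_length]
  have hlen : ∀ n, l₀.length ≤ n → l₀.length ≤ (s.take n).length := fun n hn => by
    conv_lhs => rw [← hs₀]
    exact (s.take_prefix_take hn).length_le
  have hmem : ∀ i x, l₀.length ≤ i → s.get? i = some x → x ∈ T (s.take i) := fun i x hi hx =>
    (hN₂ _ (hlen i hi)).1 x (by rw [← hs, hx])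
  have hnod : ∀ n, (s.take n).Nodup := by
    intro n
    rcases le_total n l₀.length with hn | hn
    · rw [hpre n hn]
      exact hl₀.sublist (List.take_sublist _ _)
    · induction n, hn using Nat.le_induction with
      | base => rwa [hs₀]
      | succ n hn ih =>
        rw [Stream'.Seq.take_succ_eq]
        cases hx : s.get? n with
        | none => simpa using ih
        | some x => exact hT _ x (hmem n x hn hx)
  refine ⟨s, hs₀, hnod, hmem, fun x i => ?_⟩
  -- If `x` stayed allowed, every later step would do a new event with code at most `c x`, but there
  -- are only finitely many.
  by_contra! hx
  have hex : ∀ k, ∃ y, s.get? (max i l₀.length + k) = some y ∧ c y ≤ c x := fun k => by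
    rw [hs]
    exact (hN₂ _ (hlen _ (by omega))).2 x (hx _ (by omega))
  choose y hy hyc using hex
  refine not_injective_infinite_finite
    (fun k : ℕ => (⟨c (y k), Nat.lt_succ_of_le (hyc k)⟩ : Fin (c x + 1))) fun k k' hkk => ?_
  have hyy : y k = y k' := hcinj (by simpa using hkk)
  by_contra hne
  have key : ∀ a b, a < b → y a ≠ y b := fun a b hab hyab => by
    have h1 := hnod (max i l₀.length + b + 1)
    rw [Stream'.Seq.take_succ_of_get? (hy b)] at h1
    exact (List.nodup_append.1 h1).2.2 (y a)
      (Stream'.Seq.mem_take_iff.2 ⟨_, by omega, hy a⟩) (y b) (by simp) hyab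
  rcases lt_or_gt_of_ne hne with h | h
  · exact key _ _ h hyy
  · exact key _ _ h hyy.symm

end Schedule

/-! ### Prudent events are payable, and the equivalence with traces -/

namespace CES

variable {E 𝒜 : Type*} {𝓔 : CES E} {π : E → 𝒜}

/-- When an event prescribed by a prudent strategy of `A` is done, and the other participants only
do prudent events, at some point `A` has honoured all its credits. -/
theorem PrudentStrategy.exists_play [Countable E] (hc : 𝓔.ConflictFree) {P : List E → E → Prop}
    (hP : ∀ l e, P l e → (l ++ [e]).Nodup) {A : 𝒜} {S : Strategy 𝓔 π A} {l : List E}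
    (hS : PrudentStrategy P S l) {e : E} (he : e ∈ S.toFun l) :
    ∃ m : List E, m.Nodup ∧ l ++ [e] <+: m ∧ 𝓔.credit m ∩ {x | π x = A} ⊆ 𝓔.credit l ∧
      ∀ p x, p ++ [x] <+: m → l ++ [e] <+: p → π x ≠ A → P p x := by
  have hle : (l ++ [e]).Nodup := (S.isFinPlay l e he).1
  -- `A` is allowed what `S` prescribes, the others what `P` admits; the scheduling property then
  -- yields both fairness for `S` and innocence of the others.
  obtain ⟨s, hs₀, hs, hsT, hfair⟩ := exists_fair_seq
    (fun p => {x | π x = A ∧ x ∈ S.toFun p ∨ π x ≠ A ∧ P p x})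
    (fun p x hx => hx.elim (fun h => (S.isFinPlay p x h.2).1) fun h => hP p x h.2) hle
  have hlen : (l ++ [e]).length = l.length + 1 := by simp
  rw [hlen] at hs₀ hsT
  have hsl : s.take l.length = l := by
    rw [← s.take_take_of_le l.length.le_succ, hs₀]
    simp
  have hget : ∀ i, i ≤ l.length → s.get? i = (l ++ [e])[i]? := fun i hi => by
    rw [← hs₀, Stream'.Seq.getElem?_take, if_pos (by omega)]
  have hconf : Conforms S s := by
    intro i x hx hxA
    rcases lt_trichotomy i l.length with hi | rfl | hi
    · have h := hS.1 i x (by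
        rw [Stream'.Seq.ofList_get?, ← hx, hget i hi.le, List.getElem?_append_left hi]) hxA
      rw [Stream'.Seq.take_ofList] at h
      rwa [← s.take_take_of_le hi.le, hsl]
    · rw [hget _ le_rfl] at hx
      simp only [List.getElem?_concat_length, Option.some.injEq] at hx
      rw [hsl, ← hx]
      exact he
    · exact ((hsT i x hi hx).resolve_right fun h => h.1 hxA).2
  have hfairS : Fair S s := by
    intro x i hi hx
    obtain ⟨j, hj, hxj⟩ := hfair x i
    have hall : x ∈ S.toFun (s.take j) := by
      by_cases hjl : (j : ℕ∞) ≤ s.length'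
      · exact hx j hj hjl
      · rw [not_le] at hjl
        obtain ⟨n, hn⟩ := ENat.ne_top_iff_exists.1 (ne_top_of_lt hjl)
        rw [← hn, Nat.cast_lt] at hjl
        rw [Stream'.Seq.take_eq_take_of_terminatedAt
          (Stream'.Seq.length'_le_iff.1 hn.ge : s.get? n = none) hjl.le]
        refine hx n ?_ hn.le
        rwa [← hn, Nat.cast_le] at hi
    exact absurd (.inl ⟨S.owner _ x hall, hall⟩) hxj
  have hinn : ∀ B, B ≠ A → Innocent π P B s := by
    intro B hB x hxB i
    obtain ⟨j, hj, hxj⟩ := hfair x i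
    exact ⟨j, hj, fun h => hxj (.inr ⟨by rwa [hxB], h⟩)⟩
  obtain ⟨k, hk, hcr⟩ := hS.2 s (hc.isPlay_iff.2 hs) hsl hconf hfairS hinn
  refine ⟨s.take k, hs k, ?_, hcr, ?_⟩
  · rw [← hs₀]
    exact s.take_prefix_take hk
  · intro p x hp hlp hxA
    have hx : s.get? p.length = some x ∧ s.take p.length = p := by
      obtain ⟨t, ht⟩ := hp
      have h1 : (s.take k)[p.length]? = some x := by rw [← ht]; simp
      rw [Stream'.Seq.getElem?_take] at h1
      split_ifs at h1 with h2
      refine ⟨h1, ?_⟩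
      rw [← s.take_take_of_le h2.le, ← ht]
      simp
    have := hsT _ x (by simpa using hlp.length_le) hx.1
    rw [hx.2] at this
    exact (this.resolve_left fun h => hxA h.1).2

theorem ConflictFree.enabledBy_or_of_credit_subset (hc : 𝓔.ConflictFree) {l m : List E} {e : E}
    (hm : m.Nodup) (hlm : l ++ [e] <+: m) (hcr : e ∈ 𝓔.credit m → e ∈ 𝓔.credit l) :
    𝓔.EnabledBy l e ∨ 𝓔.CircEnabledBy m e := by
  obtain ⟨b, rfl⟩ := hlm
  rw [List.append_assoc, List.singleton_append] at *
  have hel : e ∉ l := fun h => (List.nodup_append.1 hm).2.2 e h e (by simp) rfl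
  have : e ∉ 𝓔.credit (l ++ e :: b) := fun h => hel (mem_of_mem_credit (hcr h))
  rwa [hc.mem_credit_iff hm, not_and_or, not_not, not_not] at this

/-- Outside `l`, only the other participants can have credits left in `m`. Merging into `m` the
continuations that pay for their events creates no credits, and ends up enabling each such event. -/
theorem ConflictFree.payable_of_play (hc : 𝓔.ConflictFree) {A : 𝒜} {l m : List E} {e : E}
    (he : π e = A) (hm : m.Nodup) (hlm : l ++ [e] <+: m)
    (hcr : 𝓔.credit m ∩ {x | π x = A} ⊆ 𝓔.credit l)
    (hpay : ∀ p x, p ++ [x] <+: m → l ++ [e] <+: p → π x ≠ A → 𝓔.Payable p x) :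
    𝓔.Payable l e := by
  have key : ∀ r, r <+: m → ∃ n : List E, n.Nodup ∧ m <+: n ∧ 𝓔.credit n ⊆ 𝓔.credit m ∧
      ∀ p x, p ++ [x] <+: r → l ++ [e] <+: p → π x ≠ A →
        𝓔.EnabledBy p x ∨ 𝓔.CircEnabledBy n x := by
    intro r
    induction r using List.reverseRecOn with
    | nil => exact fun _ => ⟨m, hm, List.prefix_refl m, subset_rfl, fun p x h => by simp at h⟩
    | append_singleton r y ih =>
      intro hr
      have hr' : r <+: m := (List.prefix_append r [y]).trans hr
      obtain ⟨n, hn, hmn, hcn, hpn⟩ := ih hr'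
      by_cases hy : l ++ [e] <+: r ∧ π y ≠ A
      · obtain ⟨w, hw, hrw, hcw⟩ := hpay r y hr hy.1 hy.2
        obtain ⟨n', hn', hnn', hwn', hcn'⟩ :=
          hc.exists_credit_subset hn hw (hr'.trans hmn).subset hcw
        refine ⟨n', hn', hmn.trans hnn', hcn'.trans hcn, fun p x hp hlp hx => ?_⟩
        rcases List.prefix_concat_iff.1 hp with h | h
        · obtain ⟨rfl, h⟩ := List.append_inj' h rfl
          obtain rfl : x = y := by simpa using h
          exact (hc.enabledBy_or_of_credit_subset hw hrw fun h => hcw h).imp_right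
            fun h => h.mono hwn'
        · exact (hpn p x h hlp hx).imp_right fun h => h.mono hnn'.subset
      · refine ⟨n, hn, hmn, hcn, fun p x hp hlp hx => ?_⟩
        rcases List.prefix_concat_iff.1 hp with h | h
        · obtain ⟨rfl, h⟩ := List.append_inj' h rfl
          obtain rfl : x = y := by simpa using h
          exact absurd ⟨hlp, hx⟩ hy
        · exact hpn p x h hlp hx
  obtain ⟨n, hn, hmn, hcn, hpn⟩ := key m (List.prefix_refl m)
  refine ⟨n, hn, hlm.trans hmn, fun x hx => ?_⟩
  have hxm := hcn hx
  by_cases hxl : x ∈ l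
  · exact hc.mem_credit_of_prefix hm ((List.prefix_append l [e]).trans hlm) hxm hxl
  by_cases hxA : π x = A
  · exact hcr ⟨hxm, hxA⟩
  exfalso
  have hxle : x ∉ l ++ [e] := by
    simp only [List.mem_append, List.mem_singleton, hxl, false_or]
    rintro rfl
    exact hxA he
  obtain ⟨p, q, rfl⟩ := List.append_of_mem (mem_of_mem_credit hxm)
  have hpx : p ++ [x] <+: p ++ x :: q := ⟨q, by simp⟩
  have hlp : l ++ [e] <+: p := by
    rcases List.prefix_or_prefix_of_prefix hlm hpx with h | h
    · rcases List.prefix_concat_iff.1 h with h | h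
      · exact absurd (by rw [h]; simp) hxle
      · exact h
    · exact absurd (h.subset (by simp)) hxle
  obtain ⟨t, rfl⟩ := hmn
  rw [List.append_assoc, List.cons_append] at hx hn hpn
  rw [hc.mem_credit_iff hn] at hx
  exact (hpn p x hpx hlp hxA).elim hx.1 hx.2

theorem ConflictFree.prudent_iff_payable [Countable E] (hc : 𝓔.ConflictFree) {l : List E} {e : E} :
    𝓔.Prudent π l e ↔ 𝓔.Payable l e := by
  constructor
  · refine OrderHom.lfp_le (f := 𝓔.prudenceStep π) (a := 𝓔.Payable) ?_ l e
    rintro l e ⟨A, S, hS, he⟩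
    obtain ⟨m, hm, hlm, hcr, hpay⟩ := hS.exists_play hc
      (fun l e ⟨m, hm, hlm, _⟩ => hm.sublist hlm.sublist) he
    exact hc.payable_of_play (S.owner l e he) hm hlm hcr hpay
  · exact hc.payable_le (OrderHom.map_lfp _).le

/-- The measure is the number of events in `F` not yet done. A prudent event `e` is itself in `F`,
since its owner must pay for it; the events of the others in the play come after `e`, where the
measure has dropped. -/
theorem IsPrudence.iff_payable [Countable E] (hc : 𝓔.ConflictFree)
    (hfin : {e : E | ∃ X, 𝓔.enables X e ∨ 𝓔.circEnables X e}.Finite) {P : List E → E → Prop}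
    (hP : 𝓔.IsPrudence π P) {l : List E} {e : E} : P l e ↔ 𝓔.Payable l e := by
  refine ⟨?_, hc.payable_le (π := π) fun l e => (hP l e).2⟩
  set F := {e : E | ∃ X, 𝓔.enables X e ∨ 𝓔.circEnables X e}
  have hnod : ∀ l e, P l e → (l ++ [e]).Nodup := fun l e h => by
    obtain ⟨A, S, -, he⟩ := (hP l e).1 h
    exact (S.isFinPlay l e he).1
  induction hn : {x ∈ F | x ∉ l}.ncard using Nat.strong_induction_on generalizing l e with
  | _ n ih =>
  intro h
  obtain ⟨A, S, hS, he⟩ := (hP l e).1 h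
  obtain ⟨m, hm, hlm, hcr, hmove⟩ := hS.exists_play hc hnod he
  refine hc.payable_of_play (S.owner l e he) hm hlm hcr fun p x hp hlp hx =>
    ih _ ?_ rfl (hmove p x hp hlp hx)
  have heF : e ∈ F := by
    rcases hc.enabledBy_or_of_credit_subset hm hlm fun h => hcr ⟨h, S.owner l e he⟩ with
      ⟨X, hX, -⟩ | ⟨X, hX, -⟩
    · exact ⟨X, .inl hX⟩
    · exact ⟨X, .inr hX⟩
  have hel : e ∉ l := fun h' => (List.nodup_append.1 (hnod l e h)).2.2 e h' e (by simp) rfl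
  rw [← hn]
  refine Set.ncard_lt_ncard ⟨fun y hy => ⟨hy.1, fun hyl => hy.2 (hlp.subset (by simp [hyl]))⟩,
    fun hsub => ?_⟩ (hfin.subset fun _ h => h.1)
  exact (hsub ⟨heF, hel⟩).2 (hlp.subset (by simp))

theorem ConflictFree.isPrudentPlay_iff (hc : 𝓔.ConflictFree) {P : List E → E → Prop}
    (hP : ∀ l e, P l e ↔ 𝓔.Payable l e) {l : List E} :
    𝓔.IsPrudentPlay P l ↔ ∃ m : List E, (m.Nodup ∧ 𝓔.credit m = ∅) ∧ l <+: m := by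
  constructor
  · rintro ⟨-, h⟩
    have key : ∀ i, ∃ m : List E, (m.Nodup ∧ 𝓔.credit m = ∅) ∧ l.take i <+: m := by
      intro i
      induction i with
      | zero =>
        exact ⟨[], ⟨by simp, Set.eq_empty_of_forall_notMem fun x hx => by
          simpa using mem_of_mem_credit hx⟩, by simp⟩
      | succ i ih =>
        obtain ⟨m, ⟨hm, hcm⟩, hlm⟩ := ih
        rw [List.take_add_one]
        cases hx : l[i]? with
        | none => exact ⟨m, ⟨hm, hcm⟩, by simpa using hlm⟩
        | some x =>
          obtain ⟨w, hw, hlw, hcw⟩ := (hP _ _).1 (h i x hx)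
          have hlw' : l.take i <+: w := (List.prefix_append _ _).trans hlw
          -- `w` pays for the new event but may keep credits of `l.take i`; merging in the
          -- credit-free `m`, which also extends `l.take i`, pays those.
          obtain ⟨n, hn, hwn, hmn, hcn⟩ :=
            hc.exists_credit_subset hw hm hlw'.subset (by rw [hcm]; exact Set.empty_subset _)
          refine ⟨n, ⟨hn, Set.eq_empty_of_forall_notMem fun y hy => ?_⟩, hlw.trans hwn⟩
          have hyl := mem_of_mem_credit (hcw (hcn hy))
          obtain ⟨a, b, hab⟩ := List.append_of_mem hyl
          have hpre : ∀ {r : List E}, l.take i <+: r → a ++ [y] <+: r := fun hr =>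
            List.IsPrefix.trans ⟨b, by simp [hab]⟩ hr
          obtain ⟨t, ht⟩ := hpre (hlw'.trans hwn)
          rw [List.append_assoc, List.singleton_append] at ht
          rw [← ht, hc.mem_credit_iff (ht ▸ hn), ht] at hy
          rcases hc.enabledBy_or_of_credit_subset hm (hpre hlm) (by simp [hcm]) with h' | h'
          · exact hy.1 h'
          · exact hy.2 (h'.mono hmn)
    simpa using key l.length
  · rintro ⟨m, ⟨hm, hcm⟩, hlm⟩
    refine ⟨hc.isFinPlay_iff.2 (hm.sublist hlm.sublist), fun i x hx => (hP _ _).2 ⟨m, hm, ?_, ?_⟩⟩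
    · refine List.IsPrefix.trans ?_ hlm
      have : l.take i ++ [x] = l.take (i + 1) := by simp [List.take_add_one, hx]
      rw [this]
      exact List.take_prefix _ _
    · rw [hcm]
      exact Set.empty_subset _

end CES

theorem mainTheorem2 {E 𝒜 : Type*} [Countable E] (π : E → 𝒜) (𝓔 : CES E)
    (Δ : Set (HornClause E)) (hΔ : TheorySim Δ 𝓔) :
    (∀ σ : List E, 𝓔.IsPrudentPlay (𝓔.Prudent π) σ ↔ ∃ τ ∈ proofTraces Δ, σ <+: τ) ∧
    ({e : E | ∃ X, 𝓔.enables X e ∨ 𝓔.circEnables X e}.Finite →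
      ∀ P : List E → E → Prop, 𝓔.IsPrudence π P →
        ∀ σ : List E, 𝓔.IsPrudentPlay P σ ↔ ∃ τ ∈ proofTraces Δ, σ <+: τ) := by
  simp only [hΔ.mem_proofTraces_iff]
  exact ⟨fun σ => hΔ.1.isPrudentPlay_iff fun l e => hΔ.1.prudent_iff_payable,
    fun hfin P hP σ => hΔ.1.isPrudentPlay_iff fun l e => hP.iff_payable hΔ.1 hfin⟩
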